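/- **Lower bound for the encoded length of a longest common substring of run-length-encoded strings.** *Problem.* Let $\Sigma$ be a finite alphabet with at least five characters. A run-length-encoded (RLE) string $S$ of encoded length $n$ is a sequence of $n$ runs; the run $S[i]$ consists of a character $C(S[i])\in\Sigma$ and a length $R(S[i])\ge 1$, and consecutive runs have different characters. Its decoding $\tilde S$ is the ordinary string $C(S[1])^{R(S[1])}\cdots C(S[n])^{R(S[n])}$, and $|\tilde S|$ is its decoded length. A longest common substring (LCS) of two strings is a contiguous substring of both of maximum length. In the problem EL-LCS-RLE one is given oracle access to two RLE strings $A,B$ and has to output $|s|$, the encoded length of an RLE string $s$ whose decoding $\tilde s$ is an LCS of $\tilde A$ and $\tilde B$; if several LCSs exist, the encoded length of any of them is a correct answer. *Model.* The inputs are accessed through the unitaries $$O_S:\ |i\rangle|c\rangle|r\rangle\mapsto|i\rangle\,|c\oplus C(S[i])\rangle\,|r\oplus R(S[i])\rangle,\qquad S\in\{A,B\},$$ where characters are encoded injectively as bit strings of some length, run lengths are written in binary in a register of $w$ bits, and a selector qubit determines which of $O_A$, $O_B$ is applied. A query algorithm with $Q$ queries starts in a fixed basis state (with a workspace of arbitrary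 finite dimension), alternates $Q$ oracle calls with arbitrary input-independent unitaries, and at the end measures in the computational basis and outputs a number determined by the outcome. *Theorem.* There are absolute constants $c>0$ and $n_0$ such that the following holds for all such $\Sigma$ and encodings, all $n\ge n_0$, all $N\ge 8n$ and all $w$ with $N<2^w$. If a quantum query algorithm outputs, for all RLE strings $A,B$ over $\Sigma$ of encoded length $n$ and decoded length at most $N$, a correct answer to EL-LCS-RLE with probability at least $2/3$, then it makes at least $c\,n/\log^2 n$ queries. That is, EL-LCS-RLE requires $\Omega(n/\log^2 n)$ quantum queries. -/

import Mathlib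

/-- A run-length-encoded string over `α` of encoded length `n`: the `i`-th run is the character
`char i` repeated `run i` times; runs are nonempty and maximal. -/
structure RLEString (α : Type*) (n : ℕ) where
  char : Fin n → α
  run : Fin n → ℕ
  run_pos : ∀ i, 0 < run i
  char_ne : ∀ i j : Fin n, (i : ℕ) + 1 = j → char i ≠ char j

/-- The decoded string. -/
def RLEString.decode {α : Type*} {n : ℕ} (S : RLEString α n) : List α :=
  (List.ofFn fun i => List.replicate (S.run i) (S.char i)).flatten

/-- `s` is a longest common substring (contiguous) of `A` and `B`. -/
def IsLCS {α : Type*} (s A B : List α) : Prop :=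
  s <:+: A ∧ s <:+: B ∧ ∀ t : List α, t <:+: A → t <:+: B → t.length ≤ s.length

/-- `ℓ` is a correct answer to the encoded-length LCS problem on `(A, B)`: it is the encoded length
of some RLE string whose decoding is a longest common substring of the decoded inputs. -/
def IsELLCSAnswer {α : Type*} {n m : ℕ} (A : RLEString α n) (B : RLEString α m) (ℓ : ℕ) : Prop :=
  ∃ s : RLEString α ℓ, IsLCS s.decode A.decode B.decode

/-- Labels of the computational basis: a bit selecting which input is queried, the index register,
the character register (`b` qubits), the run-length register (`w` qubits) and a workspace of
dimension `d`. -/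
abbrev QBasis (n b w d : ℕ) : Type :=
  Bool × Fin n × BitVec b × BitVec w × Fin d

instance instFintypeBitVecRegister (w : ℕ) : Fintype (BitVec w) :=
  Fintype.ofEquiv (Fin (2 ^ w)) ⟨BitVec.ofFin, BitVec.toFin, fun _ => rfl, fun _ => rfl⟩

/-- The oracle for the pair `(A, B)` on basis labels: with `S = A` or `S = B` according to the
selector bit, `|i⟩|c⟩|r⟩ ↦ |i⟩|c ⊕ C(S[i])⟩|r ⊕ R(S[i])⟩`. Characters are written in binary
by `enc`, run lengths by their binary expansion. -/
def oraclePerm {α : Type*} {n b : ℕ} (w d : ℕ) (enc : α ↪ BitVec b) (A B : RLEString α n) :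
    Equiv.Perm (QBasis n b w d) :=
  Function.Involutive.toPerm
    (fun x =>
      let S := bif x.1 then B else A
      let i := x.2.1
      (x.1, i, x.2.2.1 ^^^ enc (S.char i), x.2.2.2.1 ^^^ BitVec.ofNat w (S.run i), x.2.2.2.2))
    (by
      rintro ⟨s, i, c, r, z⟩
      simp)

/-- A quantum query algorithm for pairs of RLE strings of encoded length `n`. Starting from a basis
state `init` it applies `U 0`, then alternates `queries` oracle calls with input-independent
unitaries `U 1, …, U queries`, measures in the computational basis, and outputs the number
`out x` for the measured label `x`. -/
structure QueryAlgorithm (n b w : ℕ) where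
  d : ℕ
  queries : ℕ
  U : ℕ → Matrix.unitaryGroup (QBasis n b w d) ℂ
  init : QBasis n b w d
  out : QBasis n b w d → ℕ

namespace QueryAlgorithm

/-- The state after `t` oracle calls and the unitary that follows the last of them. -/
noncomputable def state {α : Type*} {n b w : ℕ} (𝒜 : QueryAlgorithm n b w) (enc : α ↪ BitVec b)
    (A B : RLEString α n) : ℕ → QBasis n b w 𝒜.d → ℂ
  | 0 => (𝒜.U 0).1.mulVec (Pi.single 𝒜.init 1)
  | t + 1 => (𝒜.U (t + 1)).1.mulVec
      (fun x => 𝒜.state enc A B t ((oraclePerm w 𝒜.d enc A B).symm x))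

/-- The probability that the output of `𝒜` on `(A, B)` lies in `E`. -/
noncomputable def prob {α : Type*} {n b w : ℕ} (𝒜 : QueryAlgorithm n b w) (enc : α ↪ BitVec b)
    (A B : RLEString α n) (E : Set ℕ) : ℝ :=
  ∑ x, (𝒜.out ⁻¹' E).indicator (fun x => ‖𝒜.state enc A B 𝒜.queries x‖ ^ 2) x

/-- `𝒜` solves the encoded-length LCS problem, with success probability at least `2/3`, on all pairs
of RLE strings of encoded length `n` and decoded length at most `N`. -/
def SolvesELLCS {α : Type*} {n b w : ℕ} (𝒜 : QueryAlgorithm n b w) (enc : α ↪ BitVec b)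
    (N : ℕ) : Prop :=
  ∀ A B : RLEString α n, A.decode.length ≤ N → B.decode.length ≤ N →
    2 / 3 ≤ 𝒜.prob enc A B {ℓ | IsELLCSAnswer A B ℓ}

end QueryAlgorithm

/-! ### Spans of juntas on the Boolean cube -/

/-! Encode bits `x` as a string `X` of `m` runs over two alternating characters, and compare `X c^L`
with `c^L X`, where `c` is a third character. No common substring mixes `c` with other characters,
so the LCS is `c^L` (one run) or `X` (`m` runs), whichever is longer. Since the length of `X` is `m`
plus twice the Hamming weight, varying `L` makes one algorithm decide every threshold `k < weight`.

By the polynomial method, `Q` queries approximate each threshold within `1/3` by a function of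
degree `2Q`. Iterating `3t² - 2t³` lowers the error below `1/(3m)` while the degree grows by a
factor `O(log² m)`. The alternating sum of the thresholds is `(1 - parity)/2`, so the alternating
sum of the approximants is within `1/3` of it. Were their degree below `m`, they would be orthogonal
to parity, whereas `(1 - parity)/2` has correlation `-1/2` with it. Hence `Q · log² m` is at least
of order `m`. -/

/-- The functions on the cube `ι → Bool` of degree at most `d`, as the span of the functions that
depend on at most `d` coordinates. -/
def juntaSpan (ι : Type*) (d : ℕ) : Submodule ℂ ((ι → Bool) → ℂ) :=
  Submodule.span ℂ {f | ∃ S : Finset ι, S.card ≤ d ∧ DependsOn f (S : Set ι)}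

section JuntaSpan

variable {ι : Type*}

theorem mem_juntaSpan_of_dependsOn {f : (ι → Bool) → ℂ} {S : Finset ι} {d : ℕ} (hS : S.card ≤ d)
    (hf : DependsOn f (S : Set ι)) : f ∈ juntaSpan ι d :=
  Submodule.subset_span ⟨S, hS, hf⟩

theorem const_mem_juntaSpan (z : ℂ) (d : ℕ) : (fun _ => z) ∈ juntaSpan ι d :=
  mem_juntaSpan_of_dependsOn (S := ∅) (by simp) (fun _ _ _ => rfl)

theorem juntaSpan_mono {d e : ℕ} (h : d ≤ e) : juntaSpan ι d ≤ juntaSpan ι e :=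
  Submodule.span_mono fun _ ⟨S, hS, hf⟩ => ⟨S, hS.trans h, hf⟩

theorem mul_mem_juntaSpan {f g : (ι → Bool) → ℂ} {d e : ℕ} (hf : f ∈ juntaSpan ι d)
    (hg : g ∈ juntaSpan ι e) : f * g ∈ juntaSpan ι (d + e) := by
  classical
  have h := Submodule.mul_mem_mul hf hg
  rw [juntaSpan, juntaSpan, Submodule.span_mul_span] at h
  refine Submodule.span_mono ?_ h
  rintro _ ⟨f, ⟨S, hS, hf⟩, g, ⟨T, hT, hg⟩, rfl⟩
  refine ⟨S ∪ T, (Finset.card_union_le S T).trans (add_le_add hS hT), fun x y hxy => ?_⟩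
  have h1 : f x = f y := hf fun i hi => hxy i (by simp at hi; simp [hi])
  have h2 : g x = g y := hg fun i hi => hxy i (by simp at hi; simp [hi])
  simp [h1, h2]

theorem star_mem_juntaSpan {f : (ι → Bool) → ℂ} {d : ℕ} (hf : f ∈ juntaSpan ι d) :
    star f ∈ juntaSpan ι d := by
  induction hf using Submodule.span_induction with
  | mem f h =>
    obtain ⟨S, hS, hf⟩ := h
    exact mem_juntaSpan_of_dependsOn hS fun x y hxy => by simp [hf hxy]
  | zero => simp
  | add f g _ _ hf hg => rw [star_add]; exact add_mem hf hg
  | smul z f _ hf => rw [star_smul]; exact Submodule.smul_mem _ _ hf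

/-- The parity character of the cube. -/
def parityChar [Fintype ι] (x : ι → Bool) : ℂ := ∏ i, if x i then -1 else 1

theorem parityChar_eq_neg_one_pow [Fintype ι] (x : ι → Bool) :
    parityChar x = (-1) ^ (Finset.univ.filter fun i => x i = true).card := by
  simp [parityChar, Finset.prod_ite]

theorem norm_parityChar [Fintype ι] (x : ι → Bool) : ‖parityChar x‖ = 1 := by
  simp [parityChar_eq_neg_one_pow]

theorem parityChar_update_not [Fintype ι] [DecidableEq ι] (x : ι → Bool) (i : ι) :
    parityChar (Function.update x i (!x i)) = -parityChar x := by
  unfold parityChar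
  rw [← Finset.mul_prod_erase _ _ (Finset.mem_univ i),
    ← Finset.mul_prod_erase (a := i) _ (fun i => if x i then (-1 : ℂ) else 1) (Finset.mem_univ i),
    ← neg_mul]
  congr 1
  · cases h : x i <;> simp
  · refine Finset.prod_congr rfl fun j hj => ?_
    rw [Function.update_of_ne (Finset.ne_of_mem_erase hj)]

/-- Functions of degree less than the dimension of the cube are orthogonal to the parity. -/
theorem sum_parityChar_mul_eq_zero [Fintype ι] [DecidableEq ι] {f : (ι → Bool) → ℂ} {d : ℕ}
    (hf : f ∈ juntaSpan ι d) (hd : d < Fintype.card ι) : ∑ x, parityChar x * f x = 0 := by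
  induction hf using Submodule.span_induction with
  | mem f h =>
    obtain ⟨S, hS, hf⟩ := h
    obtain ⟨i, hi⟩ : ∃ i, i ∉ S := by
      by_contra! h
      have : S = Finset.univ := by ext; simp [h]
      rw [this, Finset.card_univ] at hS
      omega
    -- Flipping a coordinate outside `S` fixes `f` and negates the parity, so the terms cancel in
    -- pairs.
    refine Finset.sum_involution (fun x _ => Function.update x i (!x i)) ?_ ?_ ?_ ?_
    · intro x _
      have : f (Function.update x i (!x i)) = f x := hf fun j hj => by
        rw [Function.update_of_ne]
        rintro rfl
        exact hi hj
      rw [parityChar_update_not, this]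
      ring
    · intro x _ _ h
      have := congrFun h i
      simp at this
    · simp
    · intro x _
      simp
  | zero => simp
  | add f g _ _ hf hg => simp [mul_add, Finset.sum_add_distrib, hf, hg]
  | smul z f _ hf =>
    simp only [Pi.smul_apply, smul_eq_mul, mul_left_comm _ z]
    rw [← Finset.mul_sum, hf, mul_zero]

end JuntaSpan

/-! ### Amplification -/

/-- The polynomial map that turns a success probability into that of a majority of three. -/
def majorityThree (t : ℝ) : ℝ := 3 * t ^ 2 - 2 * t ^ 3

theorem majorityThree_one_sub (t : ℝ) : majorityThree (1 - t) = 1 - majorityThree t := by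
  unfold majorityThree; ring

theorem iterate_majorityThree_one_sub (j : ℕ) (t : ℝ) :
    majorityThree^[j] (1 - t) = 1 - majorityThree^[j] t := by
  induction j generalizing t with
  | zero => rfl
  | succ j ih => rw [Function.iterate_succ_apply, Function.iterate_succ_apply,
      majorityThree_one_sub, ih]

/-- Since `3t² - 2t³ ≤ 3t²`, three times the error is at least squared at each round. The first
round is spent on getting from `1/3` to `7/27 = 1/3 · 7/9`, strictly below the point where squaring
stalls. -/
theorem iterate_majorityThree_bounds {t : ℝ} (h0 : 0 ≤ t) (h1 : t ≤ 1 / 3) (j : ℕ) :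
    0 ≤ majorityThree^[j + 1] t ∧ majorityThree^[j + 1] t ≤ 1 / 3 * (7 / 9) ^ 2 ^ j := by
  induction j with
  | zero =>
    simp only [zero_add, Function.iterate_one, majorityThree]
    constructor <;> nlinarith [mul_nonneg h0 (sub_nonneg.2 h1), sq_nonneg t,
      mul_nonneg (sq_nonneg t) (sub_nonneg.2 h1), mul_nonneg h0 h0]
  | succ j ih =>
    rw [Function.iterate_succ_apply']
    generalize majorityThree^[j + 1] t = s at ih
    obtain ⟨hs0, hs1⟩ := ih
    have hr : (7 / 9 : ℝ) ^ 2 ^ j ≤ 1 := pow_le_one₀ (by norm_num) (by norm_num)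
    have hs : s ≤ 1 / 3 := by linarith
    have hsq : s ^ 2 ≤ (1 / 3 * (7 / 9) ^ 2 ^ j) ^ 2 := pow_le_pow_left₀ hs0 hs1 2
    have hp : (7 / 9 : ℝ) ^ 2 ^ (j + 1) = ((7 / 9) ^ 2 ^ j) ^ 2 := by rw [pow_succ, pow_mul]
    have hs3 : 0 ≤ s ^ 3 := by positivity
    unfold majorityThree
    constructor
    · nlinarith [mul_nonneg (sq_nonneg s) (sub_nonneg.2 hs)]
    · rw [hp]; linarith [mul_pow (1 / 3 : ℝ) ((7 / 9) ^ 2 ^ j) 2]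

theorem iterate_majorityThree_mem_juntaSpan {ι : Type*} {p : (ι → Bool) → ℝ} {d : ℕ}
    (hp : (fun x => (p x : ℂ)) ∈ juntaSpan ι d) (j : ℕ) :
    (fun x => ((majorityThree^[j] (p x) : ℝ) : ℂ)) ∈ juntaSpan ι (d * 3 ^ j) := by
  induction j with
  | zero => simpa using hp
  | succ j ih =>
    simp only [Function.iterate_succ_apply']
    set g : (ι → Bool) → ℂ := fun x => ((majorityThree^[j] (p x) : ℝ) : ℂ)
    have h2 := mul_mem_juntaSpan ih ih
    have h3 := mul_mem_juntaSpan h2 ih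
    have : (fun x => ((majorityThree (majorityThree^[j] (p x)) : ℝ) : ℂ))
        = (3 : ℂ) • (g * g) - (2 : ℂ) • (g * g * g) := by
      ext x
      simp only [majorityThree, g, Pi.sub_apply, Pi.smul_apply, Pi.mul_apply, smul_eq_mul]
      push_cast
      ring
    rw [this]
    refine sub_mem (Submodule.smul_mem _ _ (juntaSpan_mono ?_ h2))
      (Submodule.smul_mem _ _ (juntaSpan_mono ?_ h3)) <;>
    · rw [pow_succ]; nlinarith [Nat.zero_le (d * 3 ^ j)]

/-! ### Thresholds have large degree -/

/-- With `c` the Hamming weight, this turns thresholds into parity. -/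
theorem sum_range_neg_one_pow_mul_ite {m c : ℕ} (h : c ≤ m) :
    ∑ k ∈ Finset.range m, (-1 : ℂ) ^ k * (if k < c then 1 else 0) = (1 - (-1) ^ c) / 2 := by
  have h1 : ∑ k ∈ Finset.range m, (-1 : ℂ) ^ k * (if k < c then 1 else 0)
      = ∑ k ∈ Finset.range c, (-1 : ℂ) ^ k := by
    simp only [mul_ite, mul_one, mul_zero]
    rw [← Finset.sum_filter]
    congr 1
    ext k
    simp
    omega
  rw [h1, geom_sum_eq (by norm_num)]
  ring

/-- If all thresholds of the Hamming weight on the `m`-dimensional cube are approximated with error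
`1/3` by functions of degree `d`, then `d` is nearly as large as `m`. -/
theorem le_mul_of_approximate_thresholds {m d j : ℕ} (hm : 0 < m)
    (p : ℕ → (Fin m → Bool) → ℝ)
    (hp : ∀ k < m, (fun x => (p k x : ℂ)) ∈ juntaSpan (Fin m) d)
    (h0 : ∀ k x, 0 ≤ p k x) (h1 : ∀ k x, p k x ≤ 1)
    (hlow : ∀ k < m, ∀ x : Fin m → Bool,
      (Finset.univ.filter fun i => x i = true).card ≤ k → p k x ≤ 1 / 3)
    (hhigh : ∀ k < m, ∀ x : Fin m → Bool,
      k < (Finset.univ.filter fun i => x i = true).card → 2 / 3 ≤ p k x)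
    (hj : m * (7 / 9 : ℝ) ^ 2 ^ j ≤ 1) :
    m ≤ d * 3 ^ (j + 1) := by
  by_contra! hlt
  set δ : ℝ := 1 / 3 * (7 / 9) ^ 2 ^ j
  let wt : (Fin m → Bool) → ℕ := fun x => (Finset.univ.filter fun i => x i = true).card
  have hwt : ∀ x, wt x ≤ m := fun x => by
    simpa only [wt, Finset.card_fin] using Finset.card_filter_le Finset.univ fun i => x i = true
  let g : ℕ → (Fin m → Bool) → ℂ := fun k x => ((majorityThree^[j + 1] (p k x) : ℝ) : ℂ)
  have hg : ∀ k < m, ∑ x, parityChar x * g k x = 0 := fun k hk =>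
    sum_parityChar_mul_eq_zero (iterate_majorityThree_mem_juntaSpan (hp k hk) (j + 1)) (by simpa)
  have herr : ∀ k < m, ∀ x, ‖(if k < wt x then 1 else 0) - g k x‖ ≤ δ := by
    intro k hk x
    split_ifs with h
    · have hb := iterate_majorityThree_bounds (t := 1 - p k x) (by linarith [h1 k x])
        (by linarith [hhigh k hk x h]) j
      rw [iterate_majorityThree_one_sub] at hb
      rw [show (1 : ℂ) - g k x = ((1 - majorityThree^[j + 1] (p k x) : ℝ) : ℂ) by simp [g],
        Complex.norm_real, Real.norm_of_nonneg hb.1]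
      exact hb.2
    · have hb := iterate_majorityThree_bounds (h0 k x) (hlow k hk x (not_lt.1 h)) j
      rw [zero_sub, norm_neg, Complex.norm_real, Real.norm_of_nonneg hb.1]
      exact hb.2
  have hone : ∑ x : Fin m → Bool, parityChar x = 0 := by
    simpa using sum_parityChar_mul_eq_zero (const_mem_juntaSpan (ι := Fin m) 1 0) (by simpa)
  have hT : ∑ x : Fin m → Bool, parityChar x *
      ∑ k ∈ Finset.range m, (-1 : ℂ) ^ k * (if k < wt x then 1 else 0) = -(2 ^ m / 2) := by
    have : ∀ x : Fin m → Bool, parityChar x *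
        ∑ k ∈ Finset.range m, (-1 : ℂ) ^ k * (if k < wt x then 1 else 0)
          = parityChar x / 2 - 1 / 2 := by
      intro x
      rw [sum_range_neg_one_pow_mul_ite (hwt x), parityChar_eq_neg_one_pow]
      have : ((-1 : ℂ) ^ wt x) * (-1) ^ wt x = 1 := by rw [← mul_pow]; simp
      change (-1 : ℂ) ^ wt x * _ = (-1 : ℂ) ^ wt x / 2 - _
      linear_combination (-1 / 2) * this
    simp only [this, Finset.sum_sub_distrib, ← Finset.sum_div, hone]
    simp
  have hG : ∑ x : Fin m → Bool, parityChar x * ∑ k ∈ Finset.range m, (-1 : ℂ) ^ k * g k x = 0 := by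
    simp only [Finset.mul_sum]
    rw [Finset.sum_comm]
    refine Finset.sum_eq_zero fun k hk => ?_
    simp only [mul_left_comm (parityChar _)]
    rw [← Finset.mul_sum, hg k (Finset.mem_range.1 hk), mul_zero]
  have hle : ‖∑ x : Fin m → Bool, parityChar x *
      ∑ k ∈ Finset.range m, (-1 : ℂ) ^ k * ((if k < wt x then 1 else 0) - g k x)‖
        ≤ 2 ^ m * (m * δ) := by
    calc _ ≤ ∑ x : Fin m → Bool, (m * δ) := by
          refine norm_sum_le_of_le _ fun x _ => ?_
          rw [norm_mul, norm_parityChar, one_mul]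
          calc _ ≤ ∑ k ∈ Finset.range m, δ := norm_sum_le_of_le _ fun k hk => by
                simpa using herr k (Finset.mem_range.1 hk) x
            _ = m * δ := by simp
      _ = _ := by simp
  have hsplit : ∑ x : Fin m → Bool, parityChar x *
      ∑ k ∈ Finset.range m, (-1 : ℂ) ^ k * ((if k < wt x then 1 else 0) - g k x)
        = -(2 ^ m / 2) := by
    simp only [mul_sub, Finset.sum_sub_distrib]
    rw [hT, hG, sub_zero]
  rw [hsplit, norm_neg] at hle
  simp only [norm_div, norm_pow, Complex.norm_ofNat] at hle
  have h2 : (0 : ℝ) < 2 ^ m := by positivity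
  have hδ : m * δ ≤ 1 / 3 := by
    simp only [δ]; linarith
  -- The correlation `2^m / 2` would be at most `2^m / 3`.
  nlinarith

/-! ### Run-length-encoded strings -/

namespace RLEString

variable {α : Type*} {n : ℕ}

theorem mem_decode {S : RLEString α n} {d : α} : d ∈ S.decode ↔ ∃ i, S.char i = d := by
  simp only [decode, List.mem_flatten, List.mem_ofFn]
  constructor
  · rintro ⟨_, ⟨i, rfl⟩, h⟩
    exact ⟨i, (List.eq_of_mem_replicate h).symm⟩
  · rintro ⟨i, rfl⟩
    exact ⟨_, ⟨i, rfl⟩, List.mem_replicate.2 ⟨(S.run_pos i).ne', rfl⟩⟩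

theorem length_decode (S : RLEString α n) : S.decode.length = ∑ i, S.run i := by
  simp [decode, List.length_flatten, List.map_ofFn, List.sum_ofFn]

/-- Append a run at the end. -/
def snocRun (X : RLEString α n) (c : α) (L : ℕ) (hL : 0 < L) (hc : ∀ i, X.char i ≠ c) :
    RLEString α (n + 1) where
  char := Fin.snoc (α := fun _ => α) X.char c
  run := Fin.snoc (α := fun _ => ℕ) X.run L
  run_pos i := by
    refine Fin.lastCases ?_ (fun i => ?_) i
    · simpa
    · simpa using X.run_pos i
  char_ne i j h := by
    revert h
    refine Fin.lastCases ?_ (fun i => ?_) i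
    · have := j.2
      simp only [Fin.val_last]
      omega
    · refine Fin.lastCases ?_ (fun j => ?_) j
      · simpa using fun _ => hc i
      · simpa using X.char_ne i j

/-- Add a run at the front. -/
def consRun (X : RLEString α n) (c : α) (L : ℕ) (hL : 0 < L) (hc : ∀ i, X.char i ≠ c) :
    RLEString α (n + 1) where
  char := Fin.cons (α := fun _ => α) c X.char
  run := Fin.cons (α := fun _ => ℕ) L X.run
  run_pos i := by
    refine Fin.cases ?_ (fun i => ?_) i
    · simpa
    · simpa using X.run_pos i
  char_ne i j h := by
    revert h
    refine Fin.cases ?_ (fun j => ?_) j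
    · simp
    · refine Fin.cases ?_ (fun i => ?_) i
      · simpa using fun _ => (hc j).symm
      · simpa using X.char_ne i j

theorem decode_snocRun (X : RLEString α n) (c : α) (L : ℕ) (hL : 0 < L)
    (hc : ∀ i, X.char i ≠ c) :
    (X.snocRun c L hL hc).decode = X.decode ++ List.replicate L c := by
  rw [decode, List.ofFn_succ']
  simp [decode, snocRun]

theorem decode_consRun (X : RLEString α n) (c : α) (L : ℕ) (hL : 0 < L)
    (hc : ∀ i, X.char i ≠ c) :
    (X.consRun c L hL hc).decode = List.replicate L c ++ X.decode := by
  simp [decode, consRun, List.ofFn_succ]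

theorem le_one_of_forall_mem_decode_eq {S : RLEString α n} {c : α} (h : ∀ d ∈ S.decode, d = c) :
    n ≤ 1 := by
  by_contra! hn
  refine S.char_ne ⟨0, by omega⟩ ⟨1, hn⟩ rfl ?_
  rw [h _ (mem_decode.2 ⟨_, rfl⟩), h _ (mem_decode.2 ⟨_, rfl⟩)]

theorem eq_of_mem_decode_of_le_one {S : RLEString α n} (hn : n ≤ 1) {c d : α}
    (hc : c ∈ S.decode) (hd : d ∈ S.decode) : c = d := by
  obtain ⟨i, rfl⟩ := mem_decode.1 hc
  obtain ⟨j, rfl⟩ := mem_decode.1 hd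
  congr 1
  ext
  omega

end RLEString

/-! ### Common substrings of `X c ⋯ c` and `c ⋯ c X` -/

section CommonSubstring

variable {α : Type*}

/-- A common substring of `X c ⋯ c` and `c ⋯ c X` does not meet both blocks. -/
theorem forall_eq_or_forall_ne_of_infix {X t : List α} {c : α} {L : ℕ} (hc : c ∉ X)
    (hA : t <:+: X ++ List.replicate L c) (hB : t <:+: List.replicate L c ++ X) :
    (∀ d ∈ t, d = c) ∨ (∀ d ∈ t, d ≠ c) := by
  -- In `X c^L` only `c` follows a `c`, and in `c^L X` only `c` precedes a `c`. Both pairwise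
  -- conditions pass to `t` and together make being `c` constant along it.
  have hPA : (X ++ List.replicate L c).Pairwise (fun u v => u = c → v = c) := by
    rw [List.pairwise_append]
    refine ⟨?_, ?_, ?_⟩
    · exact List.Pairwise.imp_of_mem (R := fun _ _ => True)
        (fun ha _ _ h => absurd (h ▸ ha) hc) (List.pairwise_of_forall (fun _ _ => trivial))
    · simp [List.pairwise_replicate]
    · intro u hu v hv h
      exact List.eq_of_mem_replicate hv
  have hPB : (List.replicate L c ++ X).Pairwise (fun u v => v = c → u = c) := by
    rw [List.pairwise_append]
    refine ⟨?_, ?_, ?_⟩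
    · simp [List.pairwise_replicate]
    · exact List.Pairwise.imp_of_mem (R := fun _ _ => True)
        (fun _ hb _ h => absurd (h ▸ hb) hc) (List.pairwise_of_forall (fun _ _ => trivial))
    · intro u hu v hv h
      exact List.eq_of_mem_replicate hu
  have h := (hPA.sublist hA.sublist).and (hPB.sublist hB.sublist)
  have h' : t.Pairwise (fun u v => u = c ↔ v = c) := h.imp fun h => ⟨h.1, h.2⟩
  cases t with
  | nil => simp
  | cons u t =>
    have hu := (List.pairwise_cons.1 h').1
    by_cases huc : u = c
    · exact Or.inl (by simpa [huc] using fun v hv => (hu v hv).1 huc)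
    · exact Or.inr (by simpa [huc] using fun v hv hvc => huc ((hu v hv).2 hvc))

theorem length_le_of_infix_of_forall_eq {X t : List α} {c : α} {L : ℕ} (hc : c ∉ X)
    (hA : t <:+: X ++ List.replicate L c) (ht : ∀ d ∈ t, d = c) : t.length ≤ L := by
  classical
  have h := hA.sublist.count_le c
  rwa [List.count_append, List.count_eq_zero_of_not_mem hc, List.count_replicate_self, zero_add,
    List.count_eq_length.2 fun d hd => (ht d hd).symm] at h

theorem sublist_of_infix_of_forall_ne {X t : List α} {c : α} {L : ℕ} (hc : c ∉ X)
    (hA : t <:+: X ++ List.replicate L c) (ht : ∀ d ∈ t, d ≠ c) : t.Sublist X := by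
  classical
  have h := hA.sublist.filter (fun d => decide (d ≠ c))
  rwa [List.filter_append, List.filter_eq_self.2 (by simpa using ht),
    List.filter_eq_self.2 (by simpa using fun d (hd : d ∈ X) (h : d = c) => hc (h ▸ hd)),
    List.filter_eq_nil_iff.2 (by simp), List.append_nil] at h

end CommonSubstring

/-! ### Encoded length of the LCS of `X c^L` and `c^L X` -/

section Answer

variable {α : Type*} {m ℓ : ℕ} {X : RLEString α m} {c : α} {L : ℕ} {hL : 0 < L}
  {hc : ∀ i, X.char i ≠ c}

theorem IsELLCSAnswer.le_one_of_length_lt (hX : X.decode.length < L)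
    (h : IsELLCSAnswer (X.snocRun c L hL hc) (X.consRun c L hL hc) ℓ) : ℓ ≤ 1 := by
  obtain ⟨s, hA, hB, hmax⟩ := h
  rw [RLEString.decode_snocRun] at hA hmax
  rw [RLEString.decode_consRun] at hB hmax
  have hcX : c ∉ X.decode := fun h => by
    obtain ⟨i, hi⟩ := RLEString.mem_decode.1 h
    exact hc i hi
  have hlen := hmax (List.replicate L c) (List.suffix_append _ _).isInfix
    (List.prefix_append _ _).isInfix
  rw [List.length_replicate] at hlen
  rcases forall_eq_or_forall_ne_of_infix hcX hA hB with h | h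
  · exact RLEString.le_one_of_forall_mem_decode_eq h
  · have := (sublist_of_infix_of_forall_ne hcX hA h).length_le
    omega

theorem IsELLCSAnswer.two_le_of_lt_length (hm : 2 ≤ m) (hX : L < X.decode.length)
    (h : IsELLCSAnswer (X.snocRun c L hL hc) (X.consRun c L hL hc) ℓ) : 2 ≤ ℓ := by
  obtain ⟨s, hA, hB, hmax⟩ := h
  rw [RLEString.decode_snocRun] at hA hmax
  rw [RLEString.decode_consRun] at hB hmax
  have hcX : c ∉ X.decode := fun h => by
    obtain ⟨i, hi⟩ := RLEString.mem_decode.1 h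
    exact hc i hi
  have hlen := hmax X.decode (List.prefix_append _ _).isInfix (List.suffix_append _ _).isInfix
  rcases forall_eq_or_forall_ne_of_infix hcX hA hB with h | h
  · have := length_le_of_infix_of_forall_eq hcX hA h
    omega
  -- A sublist of `X` at least as long as `X` is `X` itself, which contains two distinct characters.
  · have heq := (sublist_of_infix_of_forall_ne hcX hA h).eq_of_length_le hlen
    by_contra! hℓ
    refine X.char_ne ⟨0, by omega⟩ ⟨1, hm⟩ rfl
      (RLEString.eq_of_mem_decode_of_le_one (S := s) (by omega) ?_ ?_) <;>
    · rw [heq]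
      exact RLEString.mem_decode.2 ⟨_, rfl⟩

end Answer

/-! ### Query algorithms and juntas -/

theorem Matrix.sum_norm_sq_mulVec_of_mem_unitaryGroup {κ : Type*} [Fintype κ] [DecidableEq κ]
    {U : Matrix κ κ ℂ} (hU : U ∈ Matrix.unitaryGroup κ ℂ) (v : κ → ℂ) :
    ∑ z, ‖U.mulVec v z‖ ^ 2 = ∑ z, ‖v z‖ ^ 2 := by
  have key : ∀ u : κ → ℂ, ((∑ z, ‖u z‖ ^ 2 : ℝ) : ℂ) = star u ⬝ᵥ u := by
    intro u
    simp [dotProduct, Complex.conj_mul']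
  have hU' : U.conjTranspose * U = 1 := Matrix.mem_unitaryGroup_iff'.1 hU
  apply Complex.ofReal_injective
  rw [key, key, Matrix.star_mulVec, ← Matrix.dotProduct_mulVec, Matrix.mulVec_mulVec, hU',
    Matrix.one_mulVec]

namespace QueryAlgorithm

variable {α : Type*} {n b w : ℕ} (𝒜 : QueryAlgorithm n b w) (enc : α ↪ BitVec b)

theorem sum_norm_sq_state (A B : RLEString α n) (t : ℕ) :
    ∑ z, ‖𝒜.state enc A B t z‖ ^ 2 = 1 := by
  induction t with
  | zero =>
    rw [state, Matrix.sum_norm_sq_mulVec_of_mem_unitaryGroup (𝒜.U 0).2,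
      Finset.sum_eq_single 𝒜.init]
    · simp
    · intro z _ hz
      simp [hz]
    · simp
  | succ t ih =>
    rw [state, Matrix.sum_norm_sq_mulVec_of_mem_unitaryGroup (𝒜.U (t + 1)).2, ← ih]
    exact Equiv.sum_comp (oraclePerm w 𝒜.d enc A B).symm fun z => ‖𝒜.state enc A B t z‖ ^ 2

theorem prob_nonneg (A B : RLEString α n) (E : Set ℕ) : 0 ≤ 𝒜.prob enc A B E :=
  Finset.sum_nonneg fun z _ => Set.indicator_nonneg (fun _ _ => by positivity) z

theorem prob_mono (A B : RLEString α n) {E F : Set ℕ} (h : E ⊆ F) :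
    𝒜.prob enc A B E ≤ 𝒜.prob enc A B F :=
  Finset.sum_le_sum fun z _ => Set.indicator_le_indicator_of_subset (Set.preimage_mono h)
    (fun _ => by positivity) z

theorem prob_add_prob_compl (A B : RLEString α n) (E : Set ℕ) :
    𝒜.prob enc A B E + 𝒜.prob enc A B Eᶜ = 1 := by
  rw [prob, prob, ← Finset.sum_add_distrib, ← 𝒜.sum_norm_sq_state enc A B 𝒜.queries]
  refine Finset.sum_congr rfl fun z _ => ?_
  rw [Set.preimage_compl]
  exact congrFun (Set.indicator_self_add_compl _ _) z

variable {ι : Type*} {A B : (ι → Bool) → RLEString α n}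

/-- If each basis state is mapped by the oracle in a way that depends on one input bit only, then
the amplitudes after `t` queries have degree at most `t`. -/
theorem state_mem_juntaSpan
    (hO : ∀ z, ∃ i, ∀ x y : ι → Bool, x i = y i →
      oraclePerm w 𝒜.d enc (A x) (B x) z = oraclePerm w 𝒜.d enc (A y) (B y) z)
    (t : ℕ) (z : QBasis n b w 𝒜.d) :
    (fun x => 𝒜.state enc (A x) (B x) t z) ∈ juntaSpan ι t := by
  induction t generalizing z with
  | zero => exact const_mem_juntaSpan _ _
  | succ t ih =>
    have hstep : ∀ u, (fun x => 𝒜.state enc (A x) (B x) t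
        ((oraclePerm w 𝒜.d enc (A x) (B x)).symm u)) ∈ juntaSpan ι (t + 1) := by
      intro u
      obtain ⟨i, hi⟩ := hO u
      have : (fun x => 𝒜.state enc (A x) (B x) t
          ((oraclePerm w 𝒜.d enc (A x) (B x)).symm u))
          = ∑ v, (fun x => 𝒜.state enc (A x) (B x) t v) *
              fun x => if oraclePerm w 𝒜.d enc (A x) (B x) u = v then 1 else 0 := by
        ext x
        simp [Finset.sum_apply]
        -- The oracle is an involution, so its inverse is definitionally the same map.
        rfl
      rw [this]
      refine sum_mem fun v _ => mul_mem_juntaSpan (ih v)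
        (mem_juntaSpan_of_dependsOn (S := {i}) (by simp) fun x y hxy => ?_)
      simp only [hi x y (hxy i (by simp))]
    have : (fun x => 𝒜.state enc (A x) (B x) (t + 1) z)
        = ∑ u, (𝒜.U (t + 1)).1 z u • fun x => 𝒜.state enc (A x) (B x) t
            ((oraclePerm w 𝒜.d enc (A x) (B x)).symm u) := by
      ext x
      simp [state, Matrix.mulVec, dotProduct, Finset.sum_apply]
    rw [this]
    exact sum_mem fun u _ => Submodule.smul_mem _ _ (hstep u)

/-- The polynomial method: acceptance probabilities have degree at most twice the number of
queries. -/
theorem prob_mem_juntaSpan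
    (hO : ∀ z, ∃ i, ∀ x y : ι → Bool, x i = y i →
      oraclePerm w 𝒜.d enc (A x) (B x) z = oraclePerm w 𝒜.d enc (A y) (B y) z)
    (E : Set ℕ) :
    (fun x => (𝒜.prob enc (A x) (B x) E : ℂ)) ∈ juntaSpan ι (2 * 𝒜.queries) := by
  classical
  have : (fun x => (𝒜.prob enc (A x) (B x) E : ℂ))
      = ∑ z, if 𝒜.out z ∈ E then (fun x => 𝒜.state enc (A x) (B x) 𝒜.queries z) *
          star (fun x => 𝒜.state enc (A x) (B x) 𝒜.queries z) else 0 := by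
    ext x
    rw [Finset.sum_apply, prob, Complex.ofReal_sum]
    refine Finset.sum_congr rfl fun z _ => ?_
    by_cases h : 𝒜.out z ∈ E
    · simp [h, Complex.mul_conj']
    · simp [h]
  rw [this]
  refine sum_mem fun z _ => ?_
  split_ifs
  · have hz := 𝒜.state_mem_juntaSpan enc hO 𝒜.queries z
    rw [two_mul]
    exact mul_mem_juntaSpan hz (star_mem_juntaSpan hz)
  · exact zero_mem _

end QueryAlgorithm

/-! ### The hard instances -/

/-- The bits of `x` as the lengths, `1` or `3`, of runs over two alternating characters. -/
def bitRuns {α : Type*} {m : ℕ} {a₀ a₁ : α} (h : a₀ ≠ a₁) (x : Fin m → Bool) : RLEString α m where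
  char i := if (i : ℕ) % 2 = 0 then a₀ else a₁
  run i := if x i then 3 else 1
  run_pos i := by split_ifs <;> norm_num
  char_ne i j hij := by
    rw [← hij]
    rcases Nat.mod_two_eq_zero_or_one i with hi | hi
    · simp [hi, Nat.add_mod, h]
    · simp [hi, Nat.add_mod, h.symm]

section HardInstances

variable {α : Type*} {m : ℕ} {a₀ a₁ c : α} {h : a₀ ≠ a₁}

/-- The parity of the length does not depend on `x`: this is why the runs have lengths `1` and `3`,
and it rules out ties with `L = m + 2k + 1`. -/
theorem length_decode_bitRuns (x : Fin m → Bool) :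
    (bitRuns h x).decode.length = m + 2 * (Finset.univ.filter fun i => x i = true).card := by
  have : ∀ i, (bitRuns h x).run i = 1 + if x i = true then 2 else 0 := by
    intro i
    simp only [bitRuns]
    split_ifs <;> rfl
  simp only [RLEString.length_decode, this, Finset.sum_add_distrib]
  simp [← Finset.sum_filter, mul_comm]

theorem bitRuns_char_ne (h0 : a₀ ≠ c) (h1 : a₁ ≠ c) (x : Fin m → Bool) (i : Fin m) :
    (bitRuns h x).char i ≠ c := by
  simp only [bitRuns]
  split_ifs <;> assumption

/-- Each run of `X` carries a single bit, and the position of the run of `c` is fixed. A query to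
that run depends on no bit, so index `0` serves as a dummy. -/
theorem oraclePerm_bitRuns_local (hm : 0 < m) {b : ℕ} (w d : ℕ) (enc : α ↪ BitVec b)
    (h0 : a₀ ≠ c) (h1 : a₁ ≠ c) {L : ℕ} (hL : 0 < L) (z : QBasis (m + 1) b w d) :
    ∃ i, ∀ x y : Fin m → Bool, x i = y i →
      oraclePerm w d enc ((bitRuns h x).snocRun c L hL (bitRuns_char_ne h0 h1 x))
          ((bitRuns h x).consRun c L hL (bitRuns_char_ne h0 h1 x)) z =
        oraclePerm w d enc ((bitRuns h y).snocRun c L hL (bitRuns_char_ne h0 h1 y))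
          ((bitRuns h y).consRun c L hL (bitRuns_char_ne h0 h1 y)) z := by
  obtain ⟨s, k, r⟩ := z
  cases s with
  | false =>
    refine Fin.lastCases ⟨⟨0, hm⟩, fun x y _ => ?_⟩ (fun k => ⟨k, fun x y hxy => ?_⟩) k
    · simp [oraclePerm, RLEString.snocRun]
    · simp [oraclePerm, RLEString.snocRun, bitRuns, hxy]
  | true =>
    refine Fin.cases ⟨⟨0, hm⟩, fun x y _ => ?_⟩ (fun k => ⟨k, fun x y hxy => ?_⟩) k
    · simp [oraclePerm, RLEString.consRun]
    · simp [oraclePerm, RLEString.consRun, bitRuns, hxy]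

end HardInstances

theorem QueryAlgorithm.SolvesELLCS.le_queries_mul {α : Type*} {m N b w j : ℕ} {enc : α ↪ BitVec b}
    {𝒜 : QueryAlgorithm (m + 1) b w} (h𝒜 : 𝒜.SolvesELLCS enc N) (hα : 3 ≤ Nat.card α) (hm : 2 ≤ m)
    (hN : 8 * (m + 1) ≤ N) (hj : m * (7 / 9 : ℝ) ^ 2 ^ j ≤ 1) :
    m ≤ 2 * 𝒜.queries * 3 ^ (j + 1) := by
  have hfin : Finite α := Nat.finite_of_card_ne_zero (by omega)
  have := Fintype.ofFinite α
  obtain ⟨a₀, a₁, c, h, h0, h1⟩ := Fintype.two_lt_card_iff.1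
    (show 2 < Fintype.card α by rw [← Nat.card_eq_fintype_card]; omega)
  have hL : ∀ k, 0 < m + 2 * k + 1 := fun k => by omega
  let A : ℕ → (Fin m → Bool) → RLEString α (m + 1) := fun k x =>
    (bitRuns h x).snocRun c (m + 2 * k + 1) (hL k) (bitRuns_char_ne h0 h1 x)
  let B : ℕ → (Fin m → Bool) → RLEString α (m + 1) := fun k x =>
    (bitRuns h x).consRun c (m + 2 * k + 1) (hL k) (bitRuns_char_ne h0 h1 x)
  -- Correct answers all lie in `E` when the weight exceeds `k`, and all outside it otherwise.
  let E : Set ℕ := {ℓ | 2 ≤ ℓ}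
  have hwt : ∀ x : Fin m → Bool, (Finset.univ.filter fun i => x i = true).card ≤ m := fun x => by
    simpa only [Finset.card_fin] using Finset.card_filter_le Finset.univ fun i => x i = true
  have hsolve : ∀ k < m, ∀ x, 2 / 3 ≤ 𝒜.prob enc (A k x) (B k x)
      {ℓ | IsELLCSAnswer (A k x) (B k x) ℓ} := by
    intro k hk x
    have := hwt x
    refine h𝒜 _ _ ?_ ?_
    · rw [RLEString.decode_snocRun, List.length_append, List.length_replicate,
        length_decode_bitRuns]
      omega
    · rw [RLEString.decode_consRun, List.length_append, List.length_replicate,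
        length_decode_bitRuns]
      omega
  have hsum : ∀ k x, 𝒜.prob enc (A k x) (B k x) E + 𝒜.prob enc (A k x) (B k x) Eᶜ = 1 :=
    fun k x => 𝒜.prob_add_prob_compl enc _ _ E
  refine le_mul_of_approximate_thresholds (by omega) (fun k x => 𝒜.prob enc (A k x) (B k x) E)
    (fun k _ => 𝒜.prob_mem_juntaSpan enc
      (oraclePerm_bitRuns_local (by omega) w 𝒜.d enc h0 h1 (hL k)) E)
    (fun k x => 𝒜.prob_nonneg enc _ _ E) (fun k x => ?_) (fun k hk x hx => ?_)
    (fun k hk x hx => ?_) hj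
  · linarith [hsum k x, 𝒜.prob_nonneg enc (A k x) (B k x) Eᶜ]
  · have hsub : {ℓ | IsELLCSAnswer (A k x) (B k x) ℓ} ⊆ Eᶜ := fun ℓ hℓ => by
      have : ℓ ≤ 1 := hℓ.le_one_of_length_lt (by rw [length_decode_bitRuns]; omega)
      simp only [E, Set.mem_compl_iff, Set.mem_ofPred_eq]
      omega
    linarith [hsum k x, hsolve k hk x, 𝒜.prob_mono enc (A k x) (B k x) hsub]
  · have hsub : {ℓ | IsELLCSAnswer (A k x) (B k x) ℓ} ⊆ E := fun ℓ hℓ =>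
      hℓ.two_le_of_lt_length hm (by rw [length_decode_bitRuns]; omega)
    exact (hsolve k hk x).trans (𝒜.prob_mono enc (A k x) (B k x) hsub)

/-- A number of amplification rounds that brings the error below `1 / x` at polylogarithmic cost. -/
theorem exists_amplification_rounds {x : ℝ} (hx : 3 ≤ x) :
    ∃ j : ℕ, x * (7 / 9 : ℝ) ^ 2 ^ j ≤ 1 ∧ (3 : ℝ) ^ (j + 1) ≤ 768 * Real.log x ^ 2 := by
  have hlog : 1 ≤ Real.log x := by
    rw [Real.le_log_iff_exp_le (by linarith)]
    linarith [Real.exp_one_lt_d9]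
  -- Then `8 log x < 2^j ≤ 16 log x`. The lower bound beats the `(9/2) log x` needed for the error;
  -- the upper one gives `768 = 3 · 16²`.
  obtain ⟨j, hj1, hj2⟩ := exists_nat_pow_near (x := 16 * Real.log x) (y := 2) (by linarith)
    (by norm_num)
  refine ⟨j, ?_, ?_⟩
  · have h1 : (7 / 9 : ℝ) ≤ Real.exp (-(2 / 9)) := by
      linarith [Real.add_one_le_exp (-(2 / 9) : ℝ)]
    have h2 : (7 / 9 : ℝ) ^ 2 ^ j ≤ Real.exp (-Real.log x) := by
      calc (7 / 9 : ℝ) ^ 2 ^ j ≤ Real.exp (-(2 / 9)) ^ 2 ^ j :=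
            pow_le_pow_left₀ (by norm_num) h1 _
        _ = Real.exp (2 ^ j * -(2 / 9)) := by rw [← Real.exp_nat_mul]; norm_num
        _ ≤ Real.exp (-Real.log x) := by
            rw [pow_succ] at hj2
            exact Real.exp_le_exp.2 (by linarith)
    rw [Real.exp_neg, Real.exp_log (by linarith)] at h2
    calc x * (7 / 9 : ℝ) ^ 2 ^ j ≤ x * x⁻¹ := by gcongr
      _ = 1 := mul_inv_cancel₀ (by linarith)
  · calc (3 : ℝ) ^ (j + 1) = 3 * 3 ^ j := by ring
      _ ≤ 3 * 4 ^ j := by gcongr; norm_num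
      _ = 3 * (2 ^ j) ^ 2 := by rw [← pow_mul, mul_comm j, pow_mul]; norm_num
      _ ≤ 3 * (16 * Real.log x) ^ 2 := by gcongr
      _ = _ := by ring

theorem mainTheorem7 :
    ∃ (c : ℝ) (n₀ : ℕ), 0 < c ∧
      ∀ (α : Type*) (n N b w : ℕ) (enc : α ↪ BitVec b) (𝒜 : QueryAlgorithm n b w),
        n₀ ≤ n → 5 ≤ Nat.card α → 8 * n ≤ N → N < 2 ^ w →
        𝒜.SolvesELLCS enc N →
        c * ((n : ℝ) / Real.log n ^ 2) ≤ 𝒜.queries := by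
  -- `3072 = 2 · 2 · 768`: from `n ≤ 2m`, from degree `2Q`, and from the cost of amplification.
  refine ⟨1 / 3072, 3, by norm_num, ?_⟩
  intro α n N b w enc 𝒜 hn hα hN _ h𝒜
  obtain ⟨m, rfl⟩ : ∃ m, n = m + 1 := ⟨n - 1, by omega⟩
  have hn' : (3 : ℝ) ≤ (m + 1 : ℕ) := by exact_mod_cast hn
  obtain ⟨j, hj, hcost⟩ := exists_amplification_rounds hn'
  have hmn : (m : ℝ) ≤ (m + 1 : ℕ) := by push_cast; linarith
  have hm : m ≤ 2 * 𝒜.queries * 3 ^ (j + 1) :=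
    h𝒜.le_queries_mul (by omega) (by omega) hN
      ((mul_le_mul_of_nonneg_right hmn (by positivity)).trans hj)
  have hm' : (m : ℝ) ≤ 2 * 𝒜.queries * 3 ^ (j + 1) := by exact_mod_cast hm
  have hlog : 0 < Real.log (m + 1 : ℕ) := Real.log_pos (by linarith)
  have hle : (m : ℝ) ≤ 2 * 𝒜.queries * (768 * Real.log (m + 1 : ℕ) ^ 2) :=
    hm'.trans (by gcongr)
  have h2 : ((m + 1 : ℕ) : ℝ) ≤ 2 * m := by push_cast at hn' ⊢; linarith
  rw [mul_div_assoc', div_le_iff₀ (by positivity)]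
  linarith
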